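/- Let $V$ be a set of $n\ge 2$ nodes and $T$ a set of $k$ tokens, $1\le k\le n$. A dynamic network is a sequence $G_1,G_2,\dots$ of connected graphs on $V$, fixed in advance (oblivious adversary). Initially every token is known to at least one node, and the initial assignment is otherwise arbitrary. For an integer $\ell\ge1$, random broadcast with $\ell$-smoothing runs in synchronous rounds $r=1,2,\dots$. In round $r$, $\ell$ edges are drawn independently and uniformly at random (with replacement) from the $\binom n2$ pairs of distinct nodes, and those not already present are added to $G_r$. Independently, each node that knows at least one token broadcasts one token chosen uniformly at random among those it knows at the beginning of the round (the choices of different nodes, and the randomness of different rounds, are independent given the current knowledge), and every neighbour of the node in the smoothed graph learns this token. Nodes do not forget tokens. $k$-message broadcast is solved once every node knows all $k$ tokens. Theorem. For all constants $x\ge 1$ and $A>0$ there is a constant $C>0$, depending only on $x$ and $A$, such that the following holds for all $n\ge2$, all $1\le k\le n$, all integers $\ell$ with $1\le \ell\le A\,n^2/\log^2 n$, every dynamic network on $n$ nodes and every initial assignment of the $k$ tokens: with probability at least $1-n^{-x}$, random broadcast with $\ell$-smoothing solves $k$-message broadcast within at most $$C\cdot\frac{k\,n^{2/3}\log^{1/3}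 n}{\ell^{1/3}}$$ rounds. -/

import Mathlib

/-- A dynamic graph on the node set `V`: a sequence of connected graphs fixed in advance (by an
oblivious adversary). `graph r` is the topology of the `(r+1)`-st round. -/
structure DynamicGraph (V : Type*) where
  graph : ℕ → SimpleGraph V
  connected : ∀ r, (graph r).Connected

/-- All potential edges on the node set `V`, i.e. the edges of the complete graph. -/
abbrev PotentialEdge (V : Type*) : Type _ := (⊤ : SimpleGraph V).edgeSet

instance PotentialEdge.instNonempty (V : Type*) [Nontrivial V] : Nonempty (PotentialEdge V) := by
  obtain ⟨a, b, hab⟩ := exists_pair_ne V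
  exact ⟨⟨s(a, b), by simpa using hab⟩⟩

/-- The graph `G` with the `ℓ` edges of the list `e` added (those not already present). -/
def smoothedGraph {V : Type*} {ℓ : ℕ} (G : SimpleGraph V) (e : Fin ℓ → PotentialEdge V) :
    SimpleGraph V :=
  G ⊔ SimpleGraph.fromEdgeSet (Set.range fun i => (e i : Sym2 V))

open Classical in
/-- `ℓ` independent, uniformly random potential edges (with replacement): the uniform
distribution on the sequences of `ℓ` potential edges. -/
noncomputable def randomEdges (V : Type*) [Fintype V] [Nontrivial V] (ℓ : ℕ) :
    PMF (Fin ℓ → PotentialEdge V) :=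
  PMF.uniformOfFintype (Fin ℓ → PotentialEdge V)

/-- The messages open to a node that knows the tokens `S`: one token of `S`, or silence (`none`)
if `S` is empty. -/
def messageOptions {T : Type*} (S : Finset T) : Finset (Option T) :=
  if S.card = 0 then {none} else S.map Function.Embedding.some

theorem messageOptions_nonempty {T : Type*} (S : Finset T) : (messageOptions S).Nonempty := by
  unfold messageOptions
  split_ifs with h
  · exact Finset.singleton_nonempty _
  · exact (Finset.card_pos.mp (Nat.pos_of_ne_zero h)).map

open Classical in
/-- The messages of one round of random broadcast, given the knowledge `K` of the nodes: every
node independently broadcasts a uniformly random token among those it knows (the uniform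
distribution on the product of the nodes' option sets). -/
noncomputable def randomMessages {V T : Type*} [Fintype V] (K : V → Finset T) :
    PMF (V → Option T) :=
  PMF.uniformOfFinset (Fintype.piFinset fun v => messageOptions (K v))
    (Fintype.piFinset_nonempty.mpr fun v => messageOptions_nonempty (K v))

open Classical in
/-- The knowledge after a round: each node keeps its tokens and receives the messages broadcast
by its neighbours in `H`. -/
noncomputable def deliver {V T : Type*} [Fintype T] (H : SimpleGraph V) (m : V → Option T)
    (K : V → Finset T) : V → Finset T :=
  fun v => K v ∪ Finset.univ.filter fun t => ∃ u, H.Adj u v ∧ m u = some t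

/-- One round of random broadcast with `ℓ`-smoothing in a round with topology `G`. The random
edges and the messages are independent. -/
noncomputable def smoothedRound {V T : Type*} [Fintype V] [Nontrivial V] [Fintype T]
    (G : SimpleGraph V) (ℓ : ℕ) (K : V → Finset T) : PMF (V → Finset T) :=
  (randomEdges V ℓ).bind fun e =>
    (randomMessages K).map fun m => deliver (smoothedGraph G e) m K

/-- The law of the knowledge of the nodes after `r` rounds of random broadcast in the dynamic
graph `𝒢` with `ℓ`-smoothing, from the initial token assignment `K₀`. -/
noncomputable def knowledgeLaw {V T : Type*} [Fintype V] [Nontrivial V] [Fintype T]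
    (𝒢 : DynamicGraph V) (ℓ : ℕ) (K₀ : V → Finset T) : ℕ → PMF (V → Finset T)
  | 0 => PMF.pure K₀
  | r + 1 => (knowledgeLaw 𝒢 ℓ K₀ r).bind fun K => smoothedRound (𝒢.graph r) ℓ K

/-- Message broadcast is solved: every node knows every token. -/
def BroadcastSolved {V T : Type*} (K : V → Finset T) : Prop :=
  ∀ v t, t ∈ K v

/-- The probability that random broadcast with `ℓ`-smoothing has not solved message broadcast
within `r` rounds. (Nodes never forget tokens, so once solved the problem stays solved, and it is
enough to look at the knowledge after round `r`.) -/
noncomputable def failureProb {V T : Type*} [Fintype V] [Nontrivial V] [Fintype T]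
    (𝒢 : DynamicGraph V) (ℓ : ℕ) (K₀ : V → Finset T) (r : ℕ) : ENNReal :=
  (knowledgeLaw 𝒢 ℓ K₀ r).toOuterMeasure {K | ¬ BroadcastSolved K}

open Finset
open scoped BigOperators

/-! Fix a token t and a node v. Give every node a fresh uniform coin with faces in T each round; a
node sends the face shown if it knows that token, and otherwise a uniform known token (or silence).
This reproduces the message law exactly (`randomMessages_finExp_le`), so the nodes knowing t
dominate a process in which informed nodes send only when their coin shows t
(`knowledgeLaw_finExp_le`). Its noise does not depend on the state, so it can be read backwards in
time from v.

Let D = n^(2/3) log^(1/3) n / ℓ^(1/3) and d = ⌈D⌉. By connectivity the informed set gains a node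
with probability at least 1/k per round, hence reaches size d in O(k(D + log n)) rounds; so does, in
reversed time, the set of nodes whose information reaches v. In between, two disjoint sets of size d
are joined by a random edge with probability of order ℓd²/n², about (log n)/D, and the sender's coin
is right with probability 1/k, so O(kD) rounds suffice. The bound on ℓ gives log n = O(D), so all
phases cost O(kD). `spreadExp_disjoint_le` combines the phases and `failureProb_le` takes the union
over t and v. -/

/-! ### Uniform averages and finite expectations. -/

theorem expect_le_expect_real {ι : Type*} [Fintype ι] {f g : ι → ℝ} (h : ∀ i, f i ≤ g i) :
    𝔼 i, f i ≤ 𝔼 i, g i :=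
  Finset.expect_le_expect fun i _ => h i

theorem expect_le_const {ι : Type*} [Fintype ι] [Nonempty ι] {f : ι → ℝ} {a : ℝ}
    (h : ∀ i, f i ≤ a) : 𝔼 i, f i ≤ a :=
  (expect_le_expect_real h).trans_eq (Fintype.expect_const a)

/-- A coordinate of a uniformly random function is uniformly distributed. -/
theorem expect_apply_coordinate {V T : Type*} [Fintype V] [DecidableEq V] [Fintype T]
    [Nonempty T] (u : V) (f : T → ℝ) : 𝔼 c : V → T, f (c u) = 𝔼 s, f s := by
  have key := Finset.prod_univ_sum (fun _ : V => (univ : Finset T))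
    (fun v s => if v = u then f s else (1 : ℝ))
  have h1 : ∀ c : V → T, ∏ v, (if v = u then f (c v) else 1) = f (c u) := fun c => by
    rw [Finset.prod_ite_eq' univ u fun v => f (c v)]; simp
  simp only [Fintype.piFinset_univ, h1] at key
  rw [Fintype.expect_eq_sum_div_card, Fintype.expect_eq_sum_div_card, ← key,
    ← Finset.mul_prod_erase univ _ (mem_univ u)]
  have h2 : ∏ v ∈ univ.erase u, ∑ s : T, (if v = u then f s else (1 : ℝ))
      = (Fintype.card T : ℝ) ^ (Fintype.card V - 1) := by
    rw [Finset.prod_congr rfl (g := fun _ => (Fintype.card T : ℝ))]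
    · simp
    · intro v hv
      simp [(Finset.mem_erase.1 hv).1]
  have hV : 0 < Fintype.card V := Fintype.card_pos_iff.2 ⟨u⟩
  have hT : (Fintype.card T : ℝ) ≠ 0 := by exact_mod_cast Fintype.card_ne_zero
  rw [h2, Fintype.card_fun]
  obtain ⟨m, hm⟩ : ∃ m, Fintype.card V = m + 1 := ⟨_, (Nat.succ_pred_eq_of_pos hV).symm⟩
  rw [hm]
  push_cast
  simp only [if_true]
  field_simp
  simp only [pow_succ, mul_assoc]

/-- A uniformly random coin with `card T` faces shows a given face with probability
`1 / card T`. -/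
theorem expect_coin {V T : Type*} [Fintype V] [DecidableEq V] [Fintype T] [DecidableEq T]
    (u : V) (t : T) (a b : ℝ) :
    𝔼 c : V → T, (if c u = t then a else b) = b + (a - b) / Fintype.card T := by
  have : Nonempty T := ⟨t⟩
  rw [expect_apply_coordinate u fun s => if s = t then a else b]
  have h : ∀ s, (if s = t then a else b) = b + if s = t then a - b else 0 := fun s => by
    split_ifs <;> ring
  simp only [h, Finset.expect_add_distrib, Fintype.expect_const]
  congr 1
  rw [Fintype.expect_eq_sum_div_card]
  simp

/-- The expectation of a real function under a probability mass function on a finite type. -/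
noncomputable def PMF.finExp {α : Type*} [Fintype α] (p : PMF α) (f : α → ℝ) : ℝ :=
  ∑ a, (p a).toReal * f a

theorem PMF.finExp_mono {α : Type*} [Fintype α] (p : PMF α) {f g : α → ℝ} (h : ∀ a, f a ≤ g a) :
    p.finExp f ≤ p.finExp g :=
  Finset.sum_le_sum fun a _ => mul_le_mul_of_nonneg_left (h a) ENNReal.toReal_nonneg

theorem PMF.finExp_pure {α : Type*} [Fintype α] (a : α) (f : α → ℝ) :
    (PMF.pure a).finExp f = f a := by
  classical
  unfold PMF.finExp
  rw [Finset.sum_eq_single a]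
  · simp
  · intro b _ hb
    simp [PMF.pure_apply, hb]
  · simp

theorem PMF.finExp_bind {α β : Type*} [Fintype α] [Fintype β] (p : PMF α) (q : α → PMF β)
    (f : β → ℝ) : (p.bind q).finExp f = p.finExp fun a => (q a).finExp f := by
  unfold PMF.finExp
  have h : ∀ b, ((p.bind q) b).toReal = ∑ a, (p a).toReal * (q a b).toReal := fun b => by
    rw [PMF.bind_apply, tsum_fintype, ENNReal.toReal_sum]
    · simp [ENNReal.toReal_mul]
    · exact fun a _ => ENNReal.mul_ne_top (p.apply_ne_top a) ((q a).apply_ne_top b)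
  simp only [h, Finset.sum_mul, Finset.mul_sum]
  rw [Finset.sum_comm]
  simp only [mul_assoc]

theorem PMF.finExp_map {α β : Type*} [Fintype α] [Fintype β] (p : PMF α) (g : α → β)
    (f : β → ℝ) : (p.map g).finExp f = p.finExp fun a => f (g a) := by
  rw [← PMF.bind_pure_comp, PMF.finExp_bind]
  simp [PMF.finExp_pure]

theorem PMF.finExp_uniformOfFintype {α : Type*} [Fintype α] [Nonempty α] (f : α → ℝ) :
    (PMF.uniformOfFintype α).finExp f = 𝔼 a, f a := by
  unfold PMF.finExp
  rw [Fintype.expect_eq_sum_div_card, Finset.sum_div]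
  refine Finset.sum_congr rfl fun a _ => ?_
  simp [div_eq_inv_mul]

theorem PMF.toOuterMeasure_eq_finExp {α : Type*} [Fintype α] (p : PMF α) (s : Set α)
    [DecidablePred (· ∈ s)] :
    p.toOuterMeasure s = ENNReal.ofReal (p.finExp fun a => if a ∈ s then 1 else 0) := by
  unfold PMF.finExp
  rw [PMF.toOuterMeasure_apply, tsum_fintype,
    ENNReal.ofReal_sum_of_nonneg fun a _ =>
      mul_nonneg ENNReal.toReal_nonneg (by split_ifs <;> simp)]
  refine Finset.sum_congr rfl fun a _ => ?_
  by_cases h : a ∈ s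
  · simp [h, ENNReal.ofReal_toReal (p.apply_ne_top a)]
  · simp [h]

/-! ### Coupling messages with uniform coins. -/

open Classical in
/-- The weight with which a node holding the tokens `S` sends the message `μ` when its coin shows
`s`: it sends `s` if it can, and otherwise a uniformly random message. -/
noncomputable def coinKernel {T : Type*} (S : Finset T) (s : T) (μ : Option T) : ℝ :=
  if s ∈ S then if μ = some s then 1 else 0
  else if μ ∈ messageOptions S then ((messageOptions S).card : ℝ)⁻¹ else 0

theorem coinKernel_nonneg {T : Type*} (S : Finset T) (s : T) (μ : Option T) :
    0 ≤ coinKernel S s μ := by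
  unfold coinKernel
  split_ifs <;> positivity

theorem sum_coinKernel {T : Type*} [Fintype T] (S : Finset T) (s : T) :
    ∑ μ, coinKernel S s μ = 1 := by
  classical
  have h := Finset.card_pos.2 (messageOptions_nonempty S)
  unfold coinKernel
  split_ifs with hs
  · simp
  · rw [Finset.sum_ite_mem, Finset.univ_inter, Finset.sum_const, nsmul_eq_mul]
    exact mul_inv_cancel₀ (by positivity)

open Classical in
/-- Averaged over a uniformly random coin, the coin kernel is uniform on the open messages. -/
theorem expect_coinKernel {T : Type*} [Fintype T] [Nonempty T]
    (S : Finset T) (μ : Option T) :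
    𝔼 s, coinKernel S s μ
      = if μ ∈ messageOptions S then ((messageOptions S).card : ℝ)⁻¹ else 0 := by
  have hk : (Fintype.card T : ℝ) ≠ 0 := by exact_mod_cast Fintype.card_ne_zero
  rw [Fintype.expect_eq_sum_div_card, div_eq_iff hk]
  unfold coinKernel
  by_cases hS : S.card = 0
  · obtain rfl := Finset.card_eq_zero.1 hS
    rcases μ with _ | s <;> simp [messageOptions]
  · have hS' : (S.card : ℝ) ≠ 0 := by exact_mod_cast hS
    have hopt : messageOptions S = S.map Function.Embedding.some := if_neg hS
    -- For nonempty S and μ = some s with s ∈ S, the total is 1 + (k - |S|)/|S| = k/|S|.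
    have hsplit : ∀ b : ℝ, ∑ s, (if s ∈ S then (if μ = some s then (1 : ℝ) else 0) else b)
        = ∑ s ∈ S, (if μ = some s then (1 : ℝ) else 0)
          + ((Fintype.card T : ℝ) - S.card) * b := fun b => by
      rw [Finset.sum_ite]
      congr 1
      · rw [Finset.filter_mem_eq_inter, Finset.univ_inter]
      · rw [Finset.sum_const, nsmul_eq_mul, Finset.filter_not, Finset.filter_mem_eq_inter,
          Finset.univ_inter, Finset.card_sdiff_of_subset (Finset.subset_univ _),
          Finset.card_univ, Nat.cast_sub (Finset.card_le_univ _)]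
    refine (hsplit _).trans ?_
    rw [hopt]
    rcases μ with _ | s
    · simp
    · by_cases hs : s ∈ S
      · simp [hs]
        field_simp
        ring
      · simp [hs]

open Classical in
/-- Random messages can be produced from a uniform coin at every node, in such a way that a node
always sends the token shown by its coin if it knows it. -/
theorem randomMessages_finExp_le {V T : Type*} [Fintype V] [Fintype T] [Nonempty T]
    (K : V → Finset T) (g : (V → Option T) → ℝ) (b : (V → T) → ℝ)
    (h : ∀ c m, (∀ v, c v ∈ K v → m v = some (c v)) → g m ≤ b c) :
    (randomMessages K).finExp g ≤ 𝔼 c, b c := by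
  have hw : ∀ m, ((randomMessages K) m).toReal = 𝔼 c : V → T, ∏ v, coinKernel (K v) (c v) (m v) := by
    intro m
    have h1 : 𝔼 c : V → T, ∏ v, coinKernel (K v) (c v) (m v)
        = ∏ v, 𝔼 s, coinKernel (K v) s (m v) := by
      rw [Fintype.expect_eq_sum_div_card]
      simp only [Fintype.expect_eq_sum_div_card]
      rw [Finset.prod_div_distrib, Finset.prod_univ_sum, Fintype.piFinset_univ]
      simp
    rw [h1]
    simp only [expect_coinKernel]
    unfold randomMessages
    rw [PMF.uniformOfFinset_apply]
    by_cases hm : ∀ v, m v ∈ messageOptions (K v)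
    · rw [if_pos (Fintype.mem_piFinset.2 hm), Finset.prod_congr rfl fun v _ => if_pos (hm v)]
      simp [Fintype.card_piFinset]
    · rw [if_neg (fun hc => hm (Fintype.mem_piFinset.1 hc))]
      push Not at hm
      obtain ⟨v, hv⟩ := hm
      rw [Finset.prod_eq_zero (mem_univ v) (if_neg hv)]
      simp
  unfold PMF.finExp
  simp only [hw, Finset.expect_mul]
  rw [← Finset.expect_sum_comm]
  refine expect_le_expect_real fun c => ?_
  have hone : ∑ m : V → Option T, ∏ v, coinKernel (K v) (c v) (m v) = 1 := by
    have := Finset.prod_univ_sum (fun _ : V => (univ : Finset (Option T)))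
      (fun v μ => coinKernel (K v) (c v) μ)
    rw [Fintype.piFinset_univ] at this
    rw [← this]
    simp only [sum_coinKernel, Finset.prod_const_one]
  calc ∑ m : V → Option T, (∏ v, coinKernel (K v) (c v) (m v)) * g m
      ≤ ∑ m : V → Option T, (∏ v, coinKernel (K v) (c v) (m v)) * b c := by
        refine Finset.sum_le_sum fun m _ => ?_
        by_cases hm : ∀ v, c v ∈ K v → m v = some (c v)
        · exact mul_le_mul_of_nonneg_left (h c m hm)
            (Finset.prod_nonneg fun v _ => coinKernel_nonneg _ _ _)
        · push Not at hm
          obtain ⟨v, hv, hne⟩ := hm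
          have : ∏ v, coinKernel (K v) (c v) (m v) = 0 :=
            Finset.prod_eq_zero (mem_univ v) (by simp [coinKernel, hv, hne])
          simp [this]
    _ = b c := by rw [← Finset.sum_mul, hone, one_mul]

/-! ### The noise of one round. -/

open Classical in
/-- The expectation of a function of the smoothed graph of a round and of a uniformly random
coin with faces in `T` at every node. -/
noncomputable def noiseExp {V T : Type*} [Fintype V] [Fintype T] (G : SimpleGraph V) (ℓ : ℕ)
    (F : SimpleGraph V → (V → T) → ℝ) : ℝ :=
  𝔼 e : Fin ℓ → PotentialEdge V, 𝔼 c : V → T, F (smoothedGraph G e) c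

section noiseExp
variable {V T : Type*} [Fintype V] [Fintype T] (G : SimpleGraph V) (ℓ : ℕ)

theorem le_smoothedGraph {V : Type*} {ℓ : ℕ} (G : SimpleGraph V) (e : Fin ℓ → PotentialEdge V) :
    G ≤ smoothedGraph G e := le_sup_left

theorem noiseExp_mono {F F' : SimpleGraph V → (V → T) → ℝ} (h : ∀ H c, F H c ≤ F' H c) :
    noiseExp G ℓ F ≤ noiseExp G ℓ F' := by
  classical exact expect_le_expect_real fun _ => expect_le_expect_real fun _ => h _ _

theorem noiseExp_const [Nontrivial V] [Nonempty T] (a : ℝ) :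
    noiseExp (T := T) G ℓ (fun _ _ => a) = a := by
  classical
  unfold noiseExp
  rw [Fintype.expect_const, Fintype.expect_const]

open Classical in
theorem noiseExp_le [Nontrivial V] {F : SimpleGraph V → (V → T) → ℝ} {a : ℝ}
    (h : ∀ H, G ≤ H → 𝔼 c : V → T, F H c ≤ a) : noiseExp G ℓ F ≤ a :=
  expect_le_const fun e => h _ (le_smoothedGraph G e)

theorem noiseExp_mul_left (a : ℝ) (F : SimpleGraph V → (V → T) → ℝ) :
    noiseExp G ℓ (fun H c => a * F H c) = a * noiseExp G ℓ F := by
  simp only [noiseExp, Finset.mul_expect]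

theorem noiseExp_add_const [Nontrivial V] [Nonempty T] (a : ℝ) (F : SimpleGraph V → (V → T) → ℝ) :
    noiseExp G ℓ (fun H c => F H c + a) = noiseExp G ℓ F + a := by
  simp only [noiseExp, Finset.expect_add_distrib, Fintype.expect_const]

/-- Fubini for the independent noise of two rounds; this is what permits reading the process
backwards. -/
theorem noiseExp_comm (G' : SimpleGraph V) (ℓ' : ℕ)
    (F : SimpleGraph V → (V → T) → SimpleGraph V → (V → T) → ℝ) :
    noiseExp G ℓ (fun H c => noiseExp G' ℓ' (F H c))
      = noiseExp G' ℓ' (fun H' c' => noiseExp G ℓ fun H c => F H c H' c') := by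
  classical
  unfold noiseExp
  have h1 : ∀ e : Fin ℓ → PotentialEdge V, ∀ e' : Fin ℓ' → PotentialEdge V,
      (𝔼 c : V → T, 𝔼 c' : V → T, F (smoothedGraph G e) c (smoothedGraph G' e') c')
        = 𝔼 c' : V → T, 𝔼 c : V → T, F (smoothedGraph G e) c (smoothedGraph G' e') c' :=
    fun e e' => Finset.expect_comm _ _ _
  calc _ = 𝔼 e : Fin ℓ → PotentialEdge V, 𝔼 e' : Fin ℓ' → PotentialEdge V,
        𝔼 c : V → T, 𝔼 c' : V → T, F (smoothedGraph G e) c (smoothedGraph G' e') c' :=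
        Finset.expect_congr rfl fun e _ => Finset.expect_comm _ _ _
    _ = 𝔼 e' : Fin ℓ' → PotentialEdge V, 𝔼 e : Fin ℓ → PotentialEdge V,
        𝔼 c' : V → T, 𝔼 c : V → T, F (smoothedGraph G e) c (smoothedGraph G' e') c' := by
        simp only [h1]
        exact Finset.expect_comm _ _ _
    _ = _ := Finset.expect_congr rfl fun e' _ => Finset.expect_comm _ _ _

end noiseExp

/-! ### Forward and backward spreading. -/

open Classical in
/-- The nodes informed after one round, if the informed nodes `S` whose coin shows `t` inform
their neighbours in `H`. -/
noncomputable def spread {V T : Type*} [Fintype V] (H : SimpleGraph V) (c : V → T) (t : T)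
    (S : Finset V) : Finset V :=
  S ∪ univ.filter fun w => ∃ u ∈ S, c u = t ∧ H.Adj u w

open Classical in
/-- The nodes whose information reaches `B` in one round. -/
noncomputable def spreadBack {V T : Type*} [Fintype V] (H : SimpleGraph V) (c : V → T) (t : T)
    (B : Finset V) : Finset V :=
  B ∪ univ.filter fun u => c u = t ∧ ∃ w ∈ B, H.Adj u w

section spread
variable {V T : Type*} [Fintype V] (H : SimpleGraph V) (c : V → T) (t : T)

theorem subset_spread (S : Finset V) : S ⊆ spread H c t S := by
  classical exact Finset.subset_union_left

theorem subset_spreadBack (S : Finset V) : S ⊆ spreadBack H c t S := by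
  classical exact Finset.subset_union_left

/-- Time-reversal duality: both sides say that S and B are disjoint and no edge leads from a node of
S with coin t to a node of B. -/
theorem disjoint_spread_iff (S B : Finset V) :
    Disjoint (spread H c t S) B ↔ Disjoint S (spreadBack H c t B) := by
  classical
  unfold spread spreadBack
  rw [Finset.disjoint_union_left, Finset.disjoint_union_right]
  refine and_congr_right fun _ => ?_
  simp only [Finset.disjoint_left, mem_filter, mem_univ, true_and]
  grind

theorem exists_adj_boundary (hH : H.Connected) {S : Finset V} (hS : S.Nonempty)
    (hne : S.card < Fintype.card V) : ∃ u ∈ S, ∃ w ∉ S, H.Adj u w := by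
  obtain ⟨u, hu⟩ := hS
  obtain ⟨w, hw⟩ : ∃ w, w ∉ S := by
    by_contra! h
    rw [Finset.eq_univ_of_forall h, Finset.card_univ] at hne
    exact hne.false
  obtain ⟨p⟩ := hH.preconnected u w
  obtain ⟨d, -, h1, h2⟩ := p.exists_boundary_dart (S : Set V) hu hw
  exact ⟨d.fst, h1, d.snd, h2, d.adj⟩

/-- An edge leaves S by connectivity. Its inner endpoint is chosen before the coins, so a single
coin decides growth. -/
theorem exists_card_lt_spread (hH : H.Connected) {S : Finset V} (hS : S.Nonempty)
    (hne : S.card < Fintype.card V) :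
    ∃ u, ∀ c : V → T, c u = t → S.card < (spread H c t S).card := by
  obtain ⟨u, hu, w, hw, h⟩ := exists_adj_boundary H hH hS hne
  refine ⟨u, fun c hc => Finset.card_lt_card ?_⟩
  refine (Finset.ssubset_iff_of_subset (subset_spread H c t S)).2 ⟨w, ?_, hw⟩
  simp only [spread, mem_union, mem_filter, mem_univ, true_and]
  exact Or.inr ⟨u, hu, hc, h⟩

/-- Here the deciding coin belongs to the outer endpoint of a boundary edge, which is the one that
sends into S. -/
theorem exists_card_lt_spreadBack (hH : H.Connected) {S : Finset V} (hS : S.Nonempty)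
    (hne : S.card < Fintype.card V) :
    ∃ u, ∀ c : V → T, c u = t → S.card < (spreadBack H c t S).card := by
  obtain ⟨u, hu, w, hw, h⟩ := exists_adj_boundary H hH hS hne
  refine ⟨w, fun c hc => Finset.card_lt_card ?_⟩
  refine (Finset.ssubset_iff_of_subset (subset_spreadBack H c t S)).2 ⟨w, ?_, hw⟩
  simp only [spreadBack, mem_union, mem_filter, mem_univ, true_and]
  exact Or.inr ⟨hc, u, hu, h.symm⟩

end spread

/-! ### The idealized process and its domination. -/

/-- The expectation of `f` at the set of informed nodes after `r` rounds of the idealized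
spreading process of the token `t`, started from the informed nodes `S`. -/
noncomputable def spreadExp {V T : Type*} [Fintype V] [Fintype T] (𝒢 : DynamicGraph V) (ℓ : ℕ)
    (t : T) : ℕ → (Finset V → ℝ) → Finset V → ℝ
  | 0, f, S => f S
  | r + 1, f, S =>
    spreadExp 𝒢 ℓ t r (fun S' => noiseExp (𝒢.graph r) ℓ fun H c => f (spread H c t S')) S

section spreadExp
variable {V T : Type*} [Fintype V] [Fintype T] (𝒢 : DynamicGraph V) (ℓ : ℕ) (t : T)

theorem spreadExp_mono {f g : Finset V → ℝ} (h : ∀ S, S.Nonempty → f S ≤ g S) (r : ℕ)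
    {S : Finset V} (hS : S.Nonempty) : spreadExp 𝒢 ℓ t r f S ≤ spreadExp 𝒢 ℓ t r g S := by
  induction r generalizing f g with
  | zero => exact h S hS
  | succ r ih =>
    exact ih fun S' hS' => noiseExp_mono _ _ fun H c => h _ (hS'.mono (subset_spread H c t S'))

theorem spreadExp_mul_left (a : ℝ) (f : Finset V → ℝ) (r : ℕ) (S : Finset V) :
    spreadExp 𝒢 ℓ t r (fun S => a * f S) S = a * spreadExp 𝒢 ℓ t r f S := by
  induction r generalizing f with
  | zero => rfl
  | succ r ih => simp only [spreadExp, noiseExp_mul_left, ih]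

theorem spreadExp_add_const [Nontrivial V] (a : ℝ) (f : Finset V → ℝ) (r : ℕ) (S : Finset V) :
    spreadExp 𝒢 ℓ t r (fun S => f S + a) S = spreadExp 𝒢 ℓ t r f S + a := by
  have : Nonempty T := ⟨t⟩
  induction r generalizing f with
  | zero => rfl
  | succ r ih => simp only [spreadExp, noiseExp_add_const, ih]

theorem spreadExp_const [Nontrivial V] (a : ℝ) (r : ℕ) (S : Finset V) :
    spreadExp 𝒢 ℓ t r (fun _ => a) S = a := by
  have : Nonempty T := ⟨t⟩
  induction r with
  | zero => rfl
  | succ r ih => simp only [spreadExp, noiseExp_const, ih]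

/-- The noise of a later round may be drawn before the earlier rounds are run. -/
theorem spreadExp_noiseExp (G : SimpleGraph V) (ℓ' : ℕ)
    (f : SimpleGraph V → (V → T) → Finset V → ℝ) (r : ℕ) (S : Finset V) :
    spreadExp 𝒢 ℓ t r (fun S' => noiseExp G ℓ' fun H c => f H c S') S
      = noiseExp G ℓ' fun H c => spreadExp 𝒢 ℓ t r (f H c) S := by
  induction r generalizing f with
  | zero => rfl
  | succ r ih =>
    simp only [spreadExp]
    rw [← ih]
    congr 1
    funext S'
    exact noiseExp_comm _ _ _ _ _

/-- A function that contracts by `ρ` in every round contracts by `ρ ^ r` in `r` rounds. -/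
theorem spreadExp_le_pow {f : Finset V → ℝ} {ρ : ℝ}
    (h : ∀ r S, S.Nonempty → noiseExp (𝒢.graph r) ℓ (fun H c => f (spread H c t S)) ≤ ρ * f S)
    (hρ : 0 ≤ ρ) (r : ℕ) {S : Finset V} (hS : S.Nonempty) :
    spreadExp 𝒢 ℓ t r f S ≤ ρ ^ r * f S := by
  induction r with
  | zero => simp [spreadExp]
  | succ r ih =>
    calc spreadExp 𝒢 ℓ t (r + 1) f S ≤ spreadExp 𝒢 ℓ t r (fun S => ρ * f S) S :=
          spreadExp_mono 𝒢 ℓ t (h r) r hS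
      _ = ρ * spreadExp 𝒢 ℓ t r f S := spreadExp_mul_left 𝒢 ℓ t ρ f r S
      _ ≤ ρ * (ρ ^ r * f S) := mul_le_mul_of_nonneg_left ih hρ
      _ = ρ ^ (r + 1) * f S := by ring

end spreadExp

/-- The nodes that know the token `t`. -/
noncomputable def informed {V T : Type*} [Fintype V] (t : T) (K : V → Finset T) : Finset V :=
  open Classical in univ.filter fun v => t ∈ K v

open Classical in
/-- The nodes knowing the token `t` stochastically dominate the idealized spreading process. -/
theorem knowledgeLaw_finExp_le {V T : Type*} [Fintype V] [Nontrivial V] [Fintype T]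
    (𝒢 : DynamicGraph V) (ℓ : ℕ) (K₀ : V → Finset T) (t : T) {f : Finset V → ℝ} (hf : Antitone f)
    (r : ℕ) :
    (knowledgeLaw 𝒢 ℓ K₀ r).finExp (fun K => f (informed t K))
      ≤ spreadExp 𝒢 ℓ t r f (informed t K₀) := by
  have : Nonempty T := ⟨t⟩
  induction r generalizing f with
  | zero => simp [knowledgeLaw, spreadExp, PMF.finExp_pure]
  | succ r ih =>
    have hanti : Antitone fun S' : Finset V =>
        noiseExp (𝒢.graph r) ℓ fun H c => f (spread H c t S') := by
      intro S S' hSS'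
      refine noiseExp_mono _ _ fun H c => hf ?_
      refine Finset.union_subset_union hSS' fun w hw => ?_
      simp only [mem_filter, mem_univ, true_and] at hw ⊢
      obtain ⟨u, hu, h⟩ := hw
      exact ⟨u, hSS' hu, h⟩
    refine le_trans ?_ (ih hanti)
    rw [knowledgeLaw, PMF.finExp_bind]
    refine PMF.finExp_mono _ fun K => ?_
    rw [smoothedRound, PMF.finExp_bind, randomEdges, PMF.finExp_uniformOfFintype]
    refine expect_le_expect_real fun e => ?_
    rw [PMF.finExp_map]
    refine randomMessages_finExp_le K _ _ fun c m hm => hf ?_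
    intro w hw
    simp only [spread, informed, mem_union, mem_filter, mem_univ, true_and, deliver] at hw ⊢
    rcases hw with hw | ⟨u, hu, rfl, hadj⟩
    · exact Or.inl hw
    · exact Or.inr ⟨u, hadj, hm u hu⟩

/-! ### Growth to size d. -/

/-- A potential that measures how far `S` is from having `d` elements. -/
noncomputable def sizePotential {V : Type*} (d : ℕ) (S : Finset V) : ℝ :=
  if S.card < d then (1 / 2) ^ S.card else 0

theorem sizePotential_nonneg {V : Type*} (d : ℕ) (S : Finset V) : 0 ≤ sizePotential d S := by
  unfold sizePotential
  split_ifs <;> positivity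

theorem sizePotential_le_one {V : Type*} (d : ℕ) (S : Finset V) : sizePotential d S ≤ 1 := by
  unfold sizePotential
  split_ifs
  · exact pow_le_one₀ (by norm_num) (by norm_num)
  · exact zero_le_one

theorem one_le_two_pow_mul_sizePotential {V : Type*} {d : ℕ} {S : Finset V} (h : S.card < d) :
    1 ≤ 2 ^ d * sizePotential d S := by
  rw [sizePotential, if_pos h]
  calc (1 : ℝ) = 2 ^ S.card * (1 / 2) ^ S.card := by rw [← mul_pow]; norm_num
    _ ≤ 2 ^ d * (1 / 2) ^ S.card := by gcongr; norm_num

theorem sizePotential_anti {V : Type*} (d : ℕ) {S S' : Finset V} (h : S.card ≤ S'.card) :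
    sizePotential d S' ≤ sizePotential d S := by
  unfold sizePotential
  split_ifs with h1 h2 h2
  · exact pow_le_pow_of_le_one (by norm_num) (by norm_num) h
  · omega
  · positivity
  · exact le_rfl

theorem sizePotential_le_half {V : Type*} (d : ℕ) {S S' : Finset V} (h : S.card < S'.card) :
    sizePotential d S' ≤ sizePotential d S / 2 := by
  unfold sizePotential
  split_ifs with h1 h2 h2
  · calc (1 / 2 : ℝ) ^ S'.card ≤ (1 / 2) ^ (S.card + 1) :=
          pow_le_pow_of_le_one (by norm_num) (by norm_num) h
      _ = (1 / 2) ^ S.card / 2 := by ring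
  · omega
  · positivity
  · simp

section growth
variable {V T : Type*} [Fintype V] [Fintype T]

-- With probability 1/k the coin of u forces growth, which at least halves the potential; otherwise
-- it does not increase. The mean factor is 1 - 1/(2k).
open Classical in
theorem expect_sizePotential_le (t : T) (d : ℕ) (S : Finset V) (S' : (V → T) → Finset V)
    (hsub : ∀ c, S ⊆ S' c)
    (hgrow : S.card < d → ∃ u, ∀ c, c u = t → S.card < (S' c).card) :
    𝔼 c, sizePotential d (S' c) ≤ (1 - 1 / (2 * Fintype.card T)) * sizePotential d S := by
  have : Nonempty T := ⟨t⟩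
  by_cases h : S.card < d
  · obtain ⟨u, hu⟩ := hgrow h
    calc 𝔼 c, sizePotential d (S' c)
        ≤ 𝔼 c : V → T, (if c u = t then sizePotential d S / 2 else sizePotential d S) := by
          refine expect_le_expect_real fun c => ?_
          split_ifs with hc
          · exact sizePotential_le_half d (hu c hc)
          · exact sizePotential_anti d (Finset.card_le_card (hsub c))
      _ = _ := by
          have hk : (Fintype.card T : ℝ) ≠ 0 := by exact_mod_cast Fintype.card_ne_zero
          rw [expect_coin]
          field_simp
          ring
  · have h0 : ∀ c, sizePotential d (S' c) = 0 := fun c =>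
      if_neg fun hc => h ((Finset.card_le_card (hsub c)).trans_lt hc)
    simp only [h0, Fintype.expect_const]
    simp [sizePotential, h]

theorem noiseExp_sizePotential_spread [Nontrivial V] {G : SimpleGraph V} (hG : G.Connected)
    (ℓ : ℕ) (t : T) {d : ℕ} (hd : d ≤ Fintype.card V) {S : Finset V} (hS : S.Nonempty) :
    noiseExp G ℓ (fun H c => sizePotential d (spread H c t S))
      ≤ (1 - 1 / (2 * Fintype.card T)) * sizePotential d S :=
  noiseExp_le G ℓ fun H hH => expect_sizePotential_le t d S _ (fun c => subset_spread H c t S)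
    fun h => exists_card_lt_spread H t (hG.mono hH) hS (h.trans_le hd)

theorem noiseExp_sizePotential_spreadBack [Nontrivial V] {G : SimpleGraph V} (hG : G.Connected)
    (ℓ : ℕ) (t : T) {d : ℕ} (hd : d ≤ Fintype.card V) {S : Finset V} (hS : S.Nonempty) :
    noiseExp G ℓ (fun H c => sizePotential d (spreadBack H c t S))
      ≤ (1 - 1 / (2 * Fintype.card T)) * sizePotential d S :=
  noiseExp_le G ℓ fun H hH => expect_sizePotential_le t d S _ (fun c => subset_spreadBack H c t S)
    fun h => exists_card_lt_spreadBack H t (hG.mono hH) hS (h.trans_le hd)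

end growth

/-! ### Random edges across a cut. -/

section hitting
variable {V : Type*} [Fintype V]

open Classical in
/-- The potential edges between `S` and `B`. -/
noncomputable def edgesBetween (S B : Finset V) : Finset (PotentialEdge V) :=
  univ.filter fun e => ∃ u ∈ S, ∃ w ∈ B, (e : Sym2 V) = s(u, w)

theorem card_mul_card_le_card_edgesBetween {S B : Finset V} (h : Disjoint S B) :
    S.card * B.card ≤ (edgesBetween S B).card := by
  classical
  have hne : ∀ p ∈ S ×ˢ B, p.1 ≠ p.2 := fun p hp hpe => by
    rw [Finset.mem_product] at hp
    exact Finset.disjoint_left.1 h hp.1 (hpe ▸ hp.2)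
  rw [← Finset.card_product, ← Finset.card_map (Function.Embedding.subtype _)]
  refine Finset.card_le_card_of_injOn (fun p => s(p.1, p.2)) (fun p hp => ?_) ?_
  · have hp' := Finset.mem_product.1 (Finset.mem_coe.1 hp)
    simp only [edgesBetween, coe_map, Set.mem_image, mem_coe, mem_filter, mem_univ, true_and]
    exact ⟨⟨s(p.1, p.2), by simpa using hne p hp⟩, ⟨p.1, hp'.1, p.2, hp'.2, rfl⟩, rfl⟩
  · rintro ⟨a, b⟩ hp ⟨a', b'⟩ hp' heq
    have h1 := Finset.mem_product.1 (Finset.mem_coe.1 hp)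
    have h2 := Finset.mem_product.1 (Finset.mem_coe.1 hp')
    rcases Sym2.eq_iff.1 heq with ⟨rfl, rfl⟩ | ⟨rfl, rfl⟩
    · rfl
    · exact absurd h2.2 (Finset.disjoint_left.1 h h1.1)

open Classical in
theorem card_potentialEdge_le :
    (Fintype.card (PotentialEdge V) : ℝ) ≤ (Fintype.card V : ℝ) ^ 2 := by
  have h : Fintype.card (PotentialEdge V) = (Fintype.card V).choose 2 := by
    rw [← SimpleGraph.card_edgeFinset_top_eq_card_choose_two, SimpleGraph.edgeFinset_card]
  rw [h]
  exact_mod_cast Nat.choose_le_pow _ _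

open Classical in
/-- The probability that `ℓ` random edges all miss the cut between two large disjoint sets. -/
theorem expect_miss_le [Nontrivial V] (ℓ : ℕ) {d : ℕ} {S B : Finset V} (hS : d ≤ S.card)
    (hB : d ≤ B.card) (h : Disjoint S B) :
    𝔼 e : Fin ℓ → PotentialEdge V, (if ∃ i, e i ∈ edgesBetween S B then (0 : ℝ) else 1)
      ≤ (1 - (d : ℝ) ^ 2 / (Fintype.card V : ℝ) ^ 2) ^ ℓ := by
  have h1 : ∀ e : Fin ℓ → PotentialEdge V,
      (if ∃ i, e i ∈ edgesBetween S B then (0 : ℝ) else 1)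
        = ∏ i, if e i ∈ edgesBetween S B then (0 : ℝ) else 1 := fun e => by
    split_ifs with he
    · obtain ⟨i, hi⟩ := he
      exact (Finset.prod_eq_zero (f := fun i => if e i ∈ edgesBetween S B then (0 : ℝ) else 1)
        (mem_univ i) (if_pos hi)).symm
    · push Not at he
      simp [he]
  have h2 := Finset.expect_pow (univ : Finset (PotentialEdge V))
    (fun e => if e ∈ edgesBetween S B then (0 : ℝ) else 1) ℓ
  rw [Fintype.piFinset_univ] at h2
  simp only [h1]
  rw [← h2]
  have hE : (0 : ℝ) < Fintype.card (PotentialEdge V) := by exact_mod_cast Fintype.card_pos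
  have h3 : 𝔼 e : PotentialEdge V, (if e ∈ edgesBetween S B then (0 : ℝ) else 1)
      = 1 - (edgesBetween S B).card / Fintype.card (PotentialEdge V) := by
    have : ∀ e, (if e ∈ edgesBetween S B then (0 : ℝ) else 1)
        = 1 - if e ∈ edgesBetween S B then (1 : ℝ) else 0 := fun e => by split_ifs <;> simp
    simp only [this, Finset.expect_sub_distrib, Fintype.expect_const]
    rw [Fintype.expect_eq_sum_div_card]
    simp
  refine pow_le_pow_left₀ (Finset.expect_nonneg fun e _ => by split_ifs <;> simp) ?_ ℓ
  rw [h3]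
  have h4 : (d : ℝ) ^ 2 ≤ (edgesBetween S B).card := by
    have := (Nat.mul_le_mul hS hB).trans (card_mul_card_le_card_edgesBetween h)
    rw [sq]
    exact_mod_cast this
  have h5 := card_potentialEdge_le (V := V)
  gcongr

-- If a random edge crosses the cut, its endpoint in S sends t with probability 1/k, independently
-- of the edges. Otherwise the trivial bound 1 is used.
open Classical in
theorem noiseExp_disjoint_spread_le {T : Type*} [Fintype T] [Nontrivial V] (G : SimpleGraph V)
    (ℓ : ℕ) (t : T) {d : ℕ} {S B : Finset V} (hS : d ≤ S.card) (hB : d ≤ B.card)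
    (h : Disjoint S B) :
    noiseExp G ℓ (fun H c => if Disjoint (spread H c t S) B then (1 : ℝ) else 0)
      ≤ 1 - (1 - (1 - (d : ℝ) ^ 2 / (Fintype.card V : ℝ) ^ 2) ^ ℓ) / Fintype.card T := by
  have : Nonempty T := ⟨t⟩
  have hk : (0 : ℝ) < Fintype.card T := by exact_mod_cast Fintype.card_pos
  have key : ∀ e : Fin ℓ → PotentialEdge V,
      𝔼 c : V → T, (if Disjoint (spread (smoothedGraph G e) c t S) B then (1 : ℝ) else 0)
        ≤ (1 - 1 / Fintype.card T)
          + 1 / Fintype.card T * if ∃ i, e i ∈ edgesBetween S B then (0 : ℝ) else 1 := by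
    intro e
    split_ifs with he
    · obtain ⟨i, hi⟩ := he
      obtain ⟨u, hu, w, hw, huw⟩ := (mem_filter.1 hi).2
      have hadj : (smoothedGraph G e).Adj u w := by
        refine Or.inr ?_
        rw [SimpleGraph.fromEdgeSet_adj]
        exact ⟨⟨i, huw⟩, fun heq => Finset.disjoint_left.1 h hu (heq ▸ hw)⟩
      calc _ ≤ 𝔼 c : V → T, (if c u = t then (0 : ℝ) else 1) := by
            refine expect_le_expect_real fun c => ?_
            by_cases hc : c u = t
            · rw [if_pos hc, if_neg]
              intro hdis
              refine (Finset.disjoint_right.1 hdis hw) ?_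
              simp only [spread, mem_union, mem_filter, mem_univ, true_and]
              exact Or.inr ⟨u, hu, hc, hadj⟩
            · rw [if_neg hc]
              split_ifs <;> simp
        _ = _ := by rw [expect_coin]; ring
    · refine (expect_le_const (a := 1) fun c => ?_).trans_eq (by ring)
      split_ifs <;> simp
  calc _ ≤ 𝔼 e : Fin ℓ → PotentialEdge V, ((1 - 1 / (Fintype.card T : ℝ))
          + 1 / Fintype.card T * if ∃ i, e i ∈ edgesBetween S B then (0 : ℝ) else 1) :=
        expect_le_expect_real key
    _ = (1 - 1 / (Fintype.card T : ℝ)) + 1 / Fintype.card T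
          * 𝔼 e : Fin ℓ → PotentialEdge V,
            (if ∃ i, e i ∈ edgesBetween S B then (0 : ℝ) else 1) := by
        rw [Finset.expect_add_distrib, Fintype.expect_const, ← Finset.mul_expect]
    _ ≤ (1 - 1 / (Fintype.card T : ℝ)) + 1 / Fintype.card T
          * (1 - (d : ℝ) ^ 2 / (Fintype.card V : ℝ) ^ 2) ^ ℓ := by
        gcongr
        exact expect_miss_le ℓ hS hB h
    _ = _ := by ring

end hitting

/-! ### Combining the three phases. -/

section phases
variable {V T : Type*} [Fintype V] [Nontrivial V] [Fintype T] (𝒢 : DynamicGraph V) (ℓ : ℕ) (t : T)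
  {d : ℕ}

/-- A lower bound for the probability that one round connects two disjoint sets of `d` nodes. -/
noncomputable def hitProb (n k ℓ d : ℕ) : ℝ := (1 - (1 - (d : ℝ) ^ 2 / (n : ℝ) ^ 2) ^ ℓ) / k

theorem hitProb_nonneg {n d : ℕ} (hd : d ≤ n) (k ℓ : ℕ) : 0 ≤ hitProb n k ℓ d := by
  have h : (d : ℝ) ^ 2 / (n : ℝ) ^ 2 ≤ 1 := div_le_one_of_le₀ (by gcongr) (by positivity)
  have h' : 0 ≤ (d : ℝ) ^ 2 / (n : ℝ) ^ 2 := by positivity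
  have := pow_le_one₀ (n := ℓ) (sub_nonneg.2 h) (by linarith)
  exact div_nonneg (by linarith) (by positivity)

theorem hitProb_le_one {n d : ℕ} (hd : d ≤ n) (k ℓ : ℕ) : hitProb n k ℓ d ≤ 1 := by
  have h : (d : ℝ) ^ 2 / (n : ℝ) ^ 2 ≤ 1 := div_le_one_of_le₀ (by gcongr) (by positivity)
  have := pow_nonneg (sub_nonneg.2 h) ℓ
  rcases Nat.eq_zero_or_pos k with rfl | hk
  · simp [hitProb]
  · have : (1 : ℝ) ≤ k := by exact_mod_cast hk
    exact div_le_one_of_le₀ (by linarith) (by positivity)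

theorem contraction_nonneg {T : Type*} [Fintype T] (t : T) :
    (0 : ℝ) ≤ 1 - 1 / (2 * Fintype.card T) := by
  have : Nonempty T := ⟨t⟩
  have : (1 : ℝ) ≤ Fintype.card T := by exact_mod_cast Fintype.card_pos
  rw [sub_nonneg, div_le_one (by positivity)]
  linarith

open Classical in
/-- The forward phase: growing to size `d`, and then connecting to a set of size `d`. -/
theorem spreadExp_disjoint_large_le (hd : d ≤ Fintype.card V) {S B : Finset V} (hS : S.Nonempty)
    (hB : d ≤ B.card) (r₁ r₂ : ℕ) :
    spreadExp 𝒢 ℓ t (r₁ + r₂) (fun S => if Disjoint S B then (1 : ℝ) else 0) S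
      ≤ 2 ^ d * (1 - 1 / (2 * Fintype.card T)) ^ r₁
        + (1 - hitProb (Fintype.card V) (Fintype.card T) ℓ d) ^ r₂ := by
  have : Nonempty T := ⟨t⟩
  set σ := 1 - hitProb (Fintype.card V) (Fintype.card T) ℓ d
  have hσ0 : 0 ≤ σ := sub_nonneg.2 (hitProb_le_one hd _ _)
  have hσ1 : σ ≤ 1 := sub_le_self _ (hitProb_nonneg hd _ _)
  -- j counts the connection rounds still to run. Small sets get the trivial bound 1; they are paid
  -- for only by the growth phase.
  let f : ℕ → Finset V → ℝ := fun j S =>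
    if S.card < d then 1 else if Disjoint S B then σ ^ j else 0
  have hf1 : ∀ j S, f j S ≤ 1 := fun j S => by
    dsimp only [f]
    have := pow_le_one₀ (n := j) hσ0 hσ1
    split_ifs <;> simp [this]
  have hstep : ∀ r j S, noiseExp (𝒢.graph r) ℓ (fun H c => f j (spread H c t S)) ≤ f (j + 1) S := by
    intro r j S
    by_cases h1 : S.card < d
    · refine (noiseExp_mono _ _ fun H c => hf1 j _).trans_eq ?_
      rw [noiseExp_const]
      simp [f, h1]
    · have hlarge : ∀ H c, ¬ (spread (T := T) H c t S).card < d := fun H c h =>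
        h1 ((Finset.card_le_card (subset_spread H c t S)).trans_lt h)
      by_cases h2 : Disjoint S B
      · calc noiseExp (𝒢.graph r) ℓ (fun H c => f j (spread H c t S))
            = noiseExp (𝒢.graph r) ℓ
                (fun H c => σ ^ j * if Disjoint (spread H c t S) B then (1 : ℝ) else 0) := by
              simp [f, hlarge]
          _ ≤ σ ^ j * σ := by
              rw [noiseExp_mul_left]
              exact mul_le_mul_of_nonneg_left
                (noiseExp_disjoint_spread_le _ ℓ t (not_lt.1 h1) hB h2) (pow_nonneg hσ0 j)
          _ = f (j + 1) S := by simp [f, h1, h2, pow_succ]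
      · have h3 : ∀ H c, ¬ Disjoint (spread (T := T) H c t S) B := fun H c h =>
          h2 (h.mono_left (subset_spread H c t S))
        simp only [f, hlarge, h3, h1, h2, if_false]
        rw [noiseExp_const]
  have hmid : ∀ r j, spreadExp 𝒢 ℓ t (r₁ + r) (f j) S ≤ spreadExp 𝒢 ℓ t r₁ (f (j + r)) S := by
    intro r
    induction r with
    | zero => exact fun j => le_rfl
    | succ r ih =>
      intro j
      calc spreadExp 𝒢 ℓ t (r₁ + r + 1) (f j) S
          ≤ spreadExp 𝒢 ℓ t (r₁ + r) (f (j + 1)) S :=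
            spreadExp_mono 𝒢 ℓ t (fun S _ => hstep _ j S) _ hS
        _ ≤ spreadExp 𝒢 ℓ t r₁ (f (j + 1 + r)) S := ih _
        _ = _ := by rw [add_right_comm, add_assoc]
  calc spreadExp 𝒢 ℓ t (r₁ + r₂) (fun S => if Disjoint S B then (1 : ℝ) else 0) S
      ≤ spreadExp 𝒢 ℓ t (r₁ + r₂) (f 0) S :=
        spreadExp_mono 𝒢 ℓ t (fun S _ => by dsimp only [f]; split_ifs <;> simp) _ hS
    _ ≤ spreadExp 𝒢 ℓ t r₁ (f r₂) S := by simpa using hmid r₂ 0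
    _ ≤ spreadExp 𝒢 ℓ t r₁ (fun S => 2 ^ d * sizePotential d S + σ ^ r₂) S := by
        refine spreadExp_mono 𝒢 ℓ t (fun S _ => ?_) _ hS
        have hp := pow_nonneg hσ0 r₂
        have hq := mul_nonneg (pow_nonneg zero_le_two d) (sizePotential_nonneg d S)
        by_cases h1 : S.card < d
        · have := one_le_two_pow_mul_sizePotential h1
          simp only [f, h1, if_true]
          linarith
        · simp only [f, h1, if_false]
          split_ifs <;> linarith
    _ = 2 ^ d * spreadExp 𝒢 ℓ t r₁ (sizePotential d) S + σ ^ r₂ := by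
        rw [spreadExp_add_const, spreadExp_mul_left]
    _ ≤ 2 ^ d * (1 - 1 / (2 * Fintype.card T)) ^ r₁ + σ ^ r₂ := by
        gcongr
        refine (spreadExp_le_pow 𝒢 ℓ t
          (fun r S hS => noiseExp_sizePotential_spread (𝒢.connected r) ℓ t hd hS)
          (contraction_nonneg t) r₁ hS).trans ?_
        exact mul_le_of_le_one_right (pow_nonneg (contraction_nonneg t) _)
          (sizePotential_le_one d S)

open Classical in
/-- The probability that the idealized process misses `B`: growth of the informed set, connection,
and growth of the set of nodes that reach `B`. -/
theorem spreadExp_disjoint_le (hd : d ≤ Fintype.card V) {S B : Finset V} (hS : S.Nonempty)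
    (hB : B.Nonempty) (r₁ r₂ r₃ : ℕ) :
    spreadExp 𝒢 ℓ t (r₁ + r₂ + r₃) (fun S => if Disjoint S B then (1 : ℝ) else 0) S
      ≤ 2 ^ d * (1 - 1 / (2 * Fintype.card T)) ^ r₁
        + (1 - hitProb (Fintype.card V) (Fintype.card T) ℓ d) ^ r₂
        + 2 ^ d * (1 - 1 / (2 * Fintype.card T)) ^ r₃ := by
  have : Nonempty T := ⟨t⟩
  set M := 2 ^ d * (1 - 1 / (2 * (Fintype.card T : ℝ))) ^ r₁
        + (1 - hitProb (Fintype.card V) (Fintype.card T) ℓ d) ^ r₂ with hM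
  set ρ := 1 - 1 / (2 * (Fintype.card T : ℝ))
  have hρ : 0 ≤ ρ := contraction_nonneg t
  have hM0 : 0 ≤ M :=
    add_nonneg (by positivity) (pow_nonneg (sub_nonneg.2 (hitProb_le_one hd _ _)) _)
  -- Keeping the potential of B in the bound lets the induction replace B by its backward spread; a
  -- plain bound would not contract.
  suffices h : spreadExp 𝒢 ℓ t (r₁ + r₂ + r₃) (fun S => if Disjoint S B then (1 : ℝ) else 0) S
      ≤ 2 ^ d * ρ ^ r₃ * sizePotential d B + M by
    have := mul_le_of_le_one_right (by positivity : 0 ≤ 2 ^ d * ρ ^ r₃) (sizePotential_le_one d B)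
    linarith
  induction r₃ generalizing B with
  | zero =>
    -- With no backward rounds left, a small B makes the potential term at least 1, so only large B
    -- needs the forward phase.
    by_cases hBd : B.card < d
    · have h1 := one_le_two_pow_mul_sizePotential hBd
      have h2 : spreadExp 𝒢 ℓ t (r₁ + r₂ + 0) (fun S => if Disjoint S B then (1 : ℝ) else 0) S
          ≤ 1 := by
        refine (spreadExp_mono 𝒢 ℓ t (g := fun _ => 1) (fun S _ => ?_) _ hS).trans_eq
          (spreadExp_const 𝒢 ℓ t 1 _ S)
        split_ifs <;> simp
      rw [pow_zero, mul_one]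
      linarith
    · have h1 := spreadExp_disjoint_large_le 𝒢 ℓ t hd hS (not_lt.1 hBd) r₁ r₂
      have h2 := sizePotential_nonneg d B
      rw [add_zero]
      exact h1.trans (le_add_of_nonneg_left (by positivity))
  | succ r₃ ih =>
    calc spreadExp 𝒢 ℓ t (r₁ + r₂ + r₃ + 1) (fun S => if Disjoint S B then (1 : ℝ) else 0) S
        = noiseExp (𝒢.graph (r₁ + r₂ + r₃)) ℓ fun H c => spreadExp 𝒢 ℓ t (r₁ + r₂ + r₃)
            (fun S => if Disjoint S (spreadBack H c t B) then (1 : ℝ) else 0) S := by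
          rw [← spreadExp_noiseExp]
          simp only [spreadExp, disjoint_spread_iff]
      _ ≤ noiseExp (𝒢.graph (r₁ + r₂ + r₃)) ℓ fun H c =>
            2 ^ d * ρ ^ r₃ * sizePotential d (spreadBack H c t B) + M :=
          noiseExp_mono _ _ fun H c => ih (hB.mono (subset_spreadBack H c t B))
      _ ≤ 2 ^ d * ρ ^ r₃ * (ρ * sizePotential d B) + M := by
          rw [noiseExp_add_const, noiseExp_mul_left]
          gcongr
          exact noiseExp_sizePotential_spreadBack (𝒢.connected _) ℓ t hd hB
      _ = 2 ^ d * ρ ^ (r₃ + 1) * sizePotential d B + M := by ring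

end phases

/-! ### Union bound and choice of parameters. -/

open Classical in
/-- Union bound over all tokens and all nodes. -/
theorem failureProb_le {V T : Type*} [Fintype V] [Nontrivial V] [Fintype T] (𝒢 : DynamicGraph V)
    (ℓ : ℕ) (K₀ : V → Finset T) (r : ℕ) {ε : ℝ}
    (h : ∀ t v, spreadExp 𝒢 ℓ t r (fun S => if Disjoint S {v} then (1 : ℝ) else 0)
      (informed t K₀) ≤ ε) :
    failureProb 𝒢 ℓ K₀ r ≤ ENNReal.ofReal (Fintype.card T * (Fintype.card V * ε)) := by
  rw [failureProb, PMF.toOuterMeasure_eq_finExp]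
  refine ENNReal.ofReal_le_ofReal ?_
  have hind : ∀ K : V → Finset T, (if K ∈ {K | ¬ BroadcastSolved K} then (1 : ℝ) else 0)
      ≤ ∑ t, ∑ v, if Disjoint (informed t K) {v} then (1 : ℝ) else 0 := by
    intro K
    have hnn : ∀ t v, (0 : ℝ) ≤ if Disjoint (informed t K) {v} then (1 : ℝ) else 0 :=
      fun t v => by split_ifs <;> simp
    split_ifs with hK
    · simp only [BroadcastSolved, Set.mem_ofPred_eq, not_forall] at hK
      obtain ⟨v, t, hvt⟩ := hK
      have h1 : (if Disjoint (informed t K) {v} then (1 : ℝ) else 0) = 1 := by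
        rw [if_pos]
        simpa [informed] using hvt
      calc (1 : ℝ) = if Disjoint (informed t K) {v} then (1 : ℝ) else 0 := h1.symm
        _ ≤ ∑ v, if Disjoint (informed t K) {v} then (1 : ℝ) else 0 :=
          Finset.single_le_sum (fun v _ => hnn t v) (mem_univ v)
        _ ≤ _ := Finset.single_le_sum
          (f := fun t => ∑ v, if Disjoint (informed t K) {v} then (1 : ℝ) else 0)
          (fun t _ => Finset.sum_nonneg fun v _ => hnn t v) (mem_univ t)
    · exact Finset.sum_nonneg fun t _ => Finset.sum_nonneg fun v _ => hnn t v
  calc _ ≤ (knowledgeLaw 𝒢 ℓ K₀ r).finExp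
        fun K => ∑ t, ∑ v, if Disjoint (informed t K) {v} then (1 : ℝ) else 0 :=
        PMF.finExp_mono _ hind
    _ = ∑ t, ∑ v, (knowledgeLaw 𝒢 ℓ K₀ r).finExp
        fun K => if Disjoint (informed t K) {v} then (1 : ℝ) else 0 := by
        unfold PMF.finExp
        simp only [Finset.mul_sum]
        rw [Finset.sum_comm]
        exact Finset.sum_congr rfl fun t _ => Finset.sum_comm
    _ ≤ ∑ _t : T, ∑ _v : V, ε := by
        refine Finset.sum_le_sum fun t _ => Finset.sum_le_sum fun v _ => ?_
        refine (knowledgeLaw_finExp_le 𝒢 ℓ K₀ t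
          (f := fun S => if Disjoint S {v} then (1 : ℝ) else 0) ?_ r).trans (h t v)
        intro S S' hSS'
        dsimp only
        by_cases h1 : Disjoint S' {v}
        · simp [h1, h1.mono_left hSS']
        · rw [if_neg h1]
          split_ifs <;> simp
    _ = Fintype.card T * (Fintype.card V * ε) := by simp

theorem one_sub_pow_le_exp {q : ℝ} (h1 : q ≤ 1) (r : ℕ) : (1 - q) ^ r ≤ Real.exp (-(q * r)) := by
  calc (1 - q) ^ r ≤ Real.exp (-q) ^ r := by
        gcongr
        exact Real.one_sub_le_exp_neg q
    _ = Real.exp (-(q * r)) := by rw [← Real.exp_nat_mul]; ring_nf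

/-- Since 2^d ≤ e^d, the r rounds must supply an exponent r/(2k) of at least d + yL. -/
theorem growth_bound {k d r : ℕ} (hk : 1 ≤ k) {D L c y : ℝ} (hd : (d : ℝ) ≤ c * D)
    (hr : (2 * c * D + 2 * (y * L)) * k ≤ r) :
    2 ^ d * (1 - 1 / (2 * (k : ℝ))) ^ r ≤ Real.exp (-(y * L)) := by
  have hk' : (1 : ℝ) ≤ k := by exact_mod_cast hk
  have h1 : (1 : ℝ) / (2 * k) ≤ 1 := by
    rw [div_le_one (by positivity)]
    linarith
  have h2 : (2 : ℝ) ^ d ≤ Real.exp d := by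
    rw [← mul_one (d : ℝ), Real.exp_nat_mul]
    gcongr
    have := Real.add_one_le_exp 1
    linarith
  calc 2 ^ d * (1 - 1 / (2 * (k : ℝ))) ^ r ≤ Real.exp d * Real.exp (-(1 / (2 * k) * r)) := by
        gcongr
        exact one_sub_pow_le_exp h1 r
    _ = Real.exp (d - 1 / (2 * k) * r) := by rw [← Real.exp_add, sub_eq_add_neg]
    _ ≤ Real.exp (-(y * L)) := by
        rw [Real.exp_le_exp]
        have h3 : c * D + y * L ≤ 1 / (2 * k) * r := by
          rw [div_mul_eq_mul_div, one_mul, le_div_iff₀ (by positivity)]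
          linarith
        linarith

/-- With p = d²/n², the choice of D gives pℓ ≥ L/D. Then (1 - p)^ℓ ≤ e^(-pℓ) ≤ 1/(1 + L/D), and L/D
≤ a keeps the loss to the factor 1 + a. -/
theorem le_hitProb {n k ℓ d : ℕ} {D L a : ℝ} (hD : 0 < D) (hL : 0 ≤ L) (hLD : L ≤ a * D)
    (hDd : D ≤ d) (hdn : d ≤ n) (hD3 : D ^ 3 * ℓ = (n : ℝ) ^ 2 * L) :
    L / D / (1 + a) / k ≤ hitProb n k ℓ d := by
  have hn : (0 : ℝ) < n := hD.trans_le (hDd.trans (by exact_mod_cast hdn))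
  have hp : (d : ℝ) ^ 2 / (n : ℝ) ^ 2 ≤ 1 := div_le_one_of_le₀ (by gcongr) (by positivity)
  have hy0 : 0 ≤ L / D := by positivity
  have hya : L / D ≤ a := by rwa [div_le_iff₀ hD]
  have h1 : L / D ≤ (d : ℝ) ^ 2 / (n : ℝ) ^ 2 * ℓ := by
    calc L / D = D ^ 2 / (n : ℝ) ^ 2 * ℓ := by
          rw [div_eq_iff hD.ne', div_mul_eq_mul_div, div_mul_eq_mul_div, eq_div_iff (by positivity)]
          linarith
      _ ≤ _ := by gcongr
  have h2 : (1 - (d : ℝ) ^ 2 / (n : ℝ) ^ 2) ^ ℓ ≤ (1 + L / D)⁻¹ := by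
    refine (one_sub_pow_le_exp hp ℓ).trans ?_
    rw [Real.exp_neg]
    gcongr
    have := Real.add_one_le_exp ((d : ℝ) ^ 2 / (n : ℝ) ^ 2 * ℓ)
    linarith
  unfold hitProb
  gcongr
  calc L / D / (1 + a) ≤ L / D / (1 + L / D) := by gcongr
    _ = 1 - (1 + L / D)⁻¹ := by field_simp; ring
    _ ≤ _ := by linarith

theorem connection_bound {n k ℓ d r : ℕ} (hk : 1 ≤ k) {D L a y : ℝ} (hD : 0 < D) (hL : 0 ≤ L)
    (hLD : L ≤ a * D) (ha : 0 ≤ a)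
    (hDd : D ≤ d) (hdn : d ≤ n) (hD3 : D ^ 3 * ℓ = (n : ℝ) ^ 2 * L)
    (hr : y * (1 + a) * D * k ≤ r) :
    (1 - hitProb n k ℓ d) ^ r ≤ Real.exp (-(y * L)) := by
  have hk' : (1 : ℝ) ≤ k := by exact_mod_cast hk
  refine (one_sub_pow_le_exp (hitProb_le_one hdn k ℓ) r).trans ?_
  rw [Real.exp_le_exp, neg_le_neg_iff]
  calc y * L = L / D / (1 + a) / k * (y * (1 + a) * D * k) := by field_simp
    _ ≤ L / D / (1 + a) / k * r := by gcongr
    _ ≤ hitProb n k ℓ d * r := by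
        gcongr
        exact le_hitProb hD hL hLD hDd hdn hD3

theorem mainTheorem1 (x : ℝ) (hx : 1 ≤ x) (A : ℝ) (hA : 0 < A) :
    ∃ C : ℝ, 0 < C ∧
      ∀ (n k ℓ : ℕ), 1 ≤ k → k ≤ n → 1 ≤ ℓ →
        (ℓ : ℝ) * Real.log n ^ 2 ≤ A * (n : ℝ) ^ 2 →
        ∀ (V T : Type*) [Fintype V] [Nontrivial V] [Fintype T],
          Fintype.card V = n → Fintype.card T = k →
          ∀ (𝒢 : DynamicGraph V) (K₀ : V → Finset T), (∀ t, ∃ v, t ∈ K₀ v) →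
            failureProb 𝒢 ℓ K₀
                ⌊C * ((k : ℝ) * (n : ℝ) ^ (2 / 3 : ℝ) * Real.log n ^ (1 / 3 : ℝ)
                  / (ℓ : ℝ) ^ (1 / 3 : ℝ))⌋₊
              ≤ ENNReal.ofReal ((n : ℝ) ^ (-x)) := by
  classical
  obtain ⟨a, ha, ha3⟩ : ∃ a : ℝ, 0 < a ∧ a ^ 3 = A :=
    ⟨A ^ (1 / 3 : ℝ), by positivity, by rw [← Real.rpow_natCast, ← Real.rpow_mul hA.le]; norm_num⟩
  -- The extra 4 pays for kn ≤ n² pairs and for 3 ≤ n², the three phase errors.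
  have hy : 0 < x + 4 := by linarith
  set y := x + 4 with hy_def
  set C' := 2 * (1 + 2 * a) + 2 * (y * a) + y * (1 + a) with hC'
  have hC'0 : 0 < C' := by positivity
  -- Three phases of C'Dk rounds each; the slack 2a absorbs rounding, because 1 ≤ 2aD.
  refine ⟨3 * (C' + 2 * a), by positivity, ?_⟩
  intro n k ℓ hk hkn hℓ hℓA V T _ _ _ hV hT 𝒢 K₀ hK₀
  have hn2 : 2 ≤ n := hV ▸ Fintype.one_lt_card
  have hn : (2 : ℝ) ≤ n := by exact_mod_cast hn2
  have hn0 : (0 : ℝ) < n := by linarith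
  have hk' : (1 : ℝ) ≤ k := by exact_mod_cast hk
  have hℓ' : (1 : ℝ) ≤ ℓ := by exact_mod_cast hℓ
  set L := Real.log n with hL_def
  have hL : 1 / 2 < L :=
    lt_of_lt_of_le (by linarith [Real.log_two_gt_d9]) (Real.log_le_log two_pos hn)
  have hL0 : 0 < L := by linarith
  obtain ⟨D, hD⟩ : ∃ D : ℝ, D = (n : ℝ) ^ (2 / 3 : ℝ) * L ^ (1 / 3 : ℝ) / (ℓ : ℝ) ^ (1 / 3 : ℝ) :=
    ⟨_, rfl⟩
  have hD0 : 0 < D := by rw [hD]; positivity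
  have hD3 : D ^ 3 * ℓ = (n : ℝ) ^ 2 * L := by
    have h1 : ((n : ℝ) ^ (2 / 3 : ℝ)) ^ 3 = (n : ℝ) ^ 2 := by
      rw [← Real.rpow_natCast, ← Real.rpow_mul hn0.le, ← Real.rpow_natCast]; norm_num
    have h2 : ∀ z : ℝ, 0 ≤ z → (z ^ (1 / 3 : ℝ)) ^ 3 = z := fun z hz => by
      rw [← Real.rpow_natCast, ← Real.rpow_mul hz]; norm_num
    rw [hD, div_pow, mul_pow, h1, h2 L hL0.le, h2 ℓ (by linarith)]
    field_simp
  -- The only use of the upper bound on ℓ.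
  have hLD : L ≤ a * D := by
    refine le_of_pow_le_pow_left₀ three_ne_zero (by positivity) ?_
    refine le_of_mul_le_mul_right (a := (ℓ : ℝ)) ?_ (by linarith)
    calc L ^ 3 * ℓ = L * (ℓ * L ^ 2) := by ring
      _ ≤ L * (A * (n : ℝ) ^ 2) := by gcongr
      _ = A * ((n : ℝ) ^ 2 * L) := by ring
      _ = (a * D) ^ 3 * ℓ := by rw [← hD3, ← ha3]; ring
  have hDn : D ≤ n := by
    refine le_of_pow_le_pow_left₀ three_ne_zero hn0.le ?_
    calc D ^ 3 ≤ D ^ 3 * ℓ := le_mul_of_one_le_right (by positivity) hℓ'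
      _ = (n : ℝ) ^ 2 * L := hD3
      _ ≤ (n : ℝ) ^ 2 * n := by gcongr; exact Real.log_le_self hn0.le
      _ = (n : ℝ) ^ 3 := by ring
  have hone : 1 ≤ 2 * a * D := by linarith
  have hdn : ⌈D⌉₊ ≤ n := Nat.ceil_le.2 hDn
  have hd : (⌈D⌉₊ : ℝ) ≤ (1 + 2 * a) * D := by
    have := Nat.ceil_lt_add_one hD0.le
    linarith
  rw [show (k : ℝ) * (n : ℝ) ^ (2 / 3 : ℝ) * L ^ (1 / 3 : ℝ) / (ℓ : ℝ) ^ (1 / 3 : ℝ) = k * D by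
    rw [hD]; ring]
  obtain ⟨R, hR⟩ : ∃ R, R = ⌊3 * (C' + 2 * a) * (k * D)⌋₊ := ⟨_, rfl⟩
  rw [← hR]
  have hRlt : 3 * (C' + 2 * a) * (k * D) < R + 1 := hR ▸ Nat.lt_floor_add_one _
  have hr : C' * D * k ≤ (R / 3 : ℕ) := by
    have h1 : (R : ℝ) ≤ 3 * (R / 3 : ℕ) + 2 := by
      have : R ≤ 3 * (R / 3) + 2 := by omega
      exact_mod_cast this
    have h2 : 1 ≤ 2 * a * D * k := one_le_mul_of_one_le_of_one_le hone hk'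
    linarith
  have hr' : C' * D * k ≤ (R - 2 * (R / 3) : ℕ) :=
    hr.trans (by exact_mod_cast (by omega : R / 3 ≤ R - 2 * (R / 3)))
  have hgrow : 2 ^ ⌈D⌉₊ * (1 - 1 / (2 * (k : ℝ))) ^ (R / 3) ≤ Real.exp (-(y * L)) := by
    refine growth_bound hk hd (le_trans ?_ hr)
    gcongr
    have h1 : 2 * (y * L) ≤ 2 * (y * (a * D)) := by gcongr
    have h2 : 0 ≤ y * (1 + a) * D := by positivity
    rw [hC']
    linarith
  have hconn : (1 - hitProb n k ℓ ⌈D⌉₊) ^ (R - 2 * (R / 3)) ≤ Real.exp (-(y * L)) := by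
    refine connection_bound hk hD0 hL0.le hLD ha.le (Nat.le_ceil D) hdn hD3 (le_trans ?_ hr')
    gcongr
    have h1 : 0 ≤ 2 * (1 + 2 * a) + 2 * (y * a) := by positivity
    rw [hC']
    linarith
  have hfail := failureProb_le 𝒢 ℓ K₀ R (ε := 3 * Real.exp (-(y * L))) fun t v => by
    obtain ⟨w, hw⟩ := hK₀ t
    have hS : (informed t K₀).Nonempty := ⟨w, by simpa [informed] using hw⟩
    have h1 := spreadExp_disjoint_le 𝒢 ℓ t (hV ▸ hdn) hS (Finset.singleton_nonempty v)
      (R / 3) (R - 2 * (R / 3)) (R / 3)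
    rw [hV, hT, show R / 3 + (R - 2 * (R / 3)) + R / 3 = R by omega] at h1
    exact h1.trans (by linarith)
  refine hfail.trans (ENNReal.ofReal_le_ofReal ?_)
  rw [hV, hT]
  have hexp : Real.exp (-(y * L)) = (n : ℝ) ^ (-x) / (n : ℝ) ^ 4 := by
    rw [← Real.rpow_natCast, ← Real.rpow_sub hn0, Real.rpow_def_of_pos hn0, hy_def]
    congr 1
    push_cast
    ring
  rw [hexp]
  calc (k : ℝ) * (n * (3 * ((n : ℝ) ^ (-x) / (n : ℝ) ^ 4)))
      ≤ n * (n * ((n : ℝ) ^ 2 * ((n : ℝ) ^ (-x) / (n : ℝ) ^ 4))) := by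
        gcongr
        nlinarith
    _ = (n : ℝ) ^ (-x) := by field_simp
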